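/- **Definitions.** All spaces are complex. A *quasi \*-algebra* $(\mathfrak A,\mathfrak A_0)$ is a vector space $\mathfrak A$ with a conjugate-linear involution $*$, together with a \*-algebra $\mathfrak A_0\subseteq\mathfrak A$ (a subspace, with the involution inherited from $\mathfrak A$) and bilinear products $ax$, $xa$ ($a\in\mathfrak A$, $x\in\mathfrak A_0$) extending the product of $\mathfrak A_0$, such that $(xa)y=x(ay)$, $a(xy)=(ax)y$, $(ax)^*=x^*a^*$, $(xa)^*=a^*x^*$. It is *unital* if there is a unique $e\in\mathfrak A_0$ with $ae=a=ea$ for all $a\in\mathfrak A$. It is a *normed quasi \*-algebra* if $\mathfrak A$ carries a norm with $\|a^*\|=\|a\|$, $\mathfrak A_0$ is dense in $\mathfrak A$, and $a\mapsto ax$ is continuous for every $x\in\mathfrak A_0$; it is a *Banach quasi \*-algebra* if moreover $\mathfrak A$ is complete. Let $(\mathfrak A,\mathfrak A_0)$ be a quasi \*-algebra with a norm on $\mathfrak A$. Let $\mathcal R_c(\mathfrak A,\mathfrak A_0)$ be the set of continuous linear functionals $\omega$ on $\mathfrak A$ that are *representable*: $\omega(x^*x)\ge 0$ and $\omega(y^*a^*x)=\overline{\omega(x^*ay)}$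 for all $x,y\in\mathfrak A_0$, $a\in\mathfrak A$, and for every $a\in\mathfrak A$ there is $\gamma_a>0$ with $|\omega(a^*x)|\le\gamma_a\,\omega(x^*x)^{1/2}$ for all $x\in\mathfrak A_0$. Put $\varphi_\omega(x,y)=\omega(y^*x)$ for $x,y\in\mathfrak A_0$, and let $\mathcal D(\overline\varphi_\omega)$ be the set of $a\in\mathfrak A$ for which there is a sequence $(x_n)$ in $\mathfrak A_0$ with $\|x_n-a\|\to0$ and $\varphi_\omega(x_n-x_m,x_n-x_m)\to0$ as $n,m\to\infty$. Let $\mathfrak A^+$ be the norm closure of the set of finite sums $\sum_k x_k^*x_k$, $x_k\in\mathfrak A_0$. Then $(\mathfrak A,\mathfrak A_0)$ is *fully representable* if 1. $\mathcal R_c(\mathfrak A,\mathfrak A_0)$ is sufficient: its members are non-negative on $\mathfrak A^+$, and for every $0\ne a\in\mathfrak A^+$ there is $\omega\in\mathcal R_c(\mathfrak A,\mathfrak A_0)$ with $\omega(a)>0$; and 2. $\bigcap_{\omega\in\mathcal R_c(\mathfrak A,\mathfrak A_0)}\mathcal D(\overline\varphi_\omega)=\mathfrak A$. It satisfies *condition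 (P)* if every $a\in\mathfrak A$ with $\omega(x^*ax)\ge0$ for all $\omega\in\mathcal R_c(\mathfrak A,\mathfrak A_0)$ and all $x\in\mathfrak A_0$ belongs to $\mathfrak A^+$. For quasi \*-algebras $(\mathfrak A,\mathfrak A_0)$, $(\mathfrak B,\mathfrak B_0)$ the algebraic tensor product $\mathfrak A\otimes\mathfrak B$ is a quasi \*-algebra over $\mathfrak A_0\otimes\mathfrak B_0$ with $(x\otimes y)(a\otimes b)=xa\otimes yb$, $(a\otimes b)(x\otimes y)=ax\otimes by$, $(a\otimes b)^*=a^*\otimes b^*$. A *uniform cross-norm* $\bar n$ on $\mathfrak A\otimes\mathfrak B$ is a norm with $\|a\otimes b\|_{\bar n}=\|a\|\,\|b\|$ and $\|(T\otimes S)c\|_{\bar n}\le\|T\|\,\|S\|\,\|c\|_{\bar n}$ for all $c\in\mathfrak A\otimes\mathfrak B$ and all bounded linear operators $T$ on $\mathfrak A$ and $S$ on $\mathfrak B$. Write $\mathfrak A\otimes_{\bar n}\mathfrak B$ for $\mathfrak A\otimes\mathfrak B$ with this norm (not completed). A normed space is *barrelled* if every lower semicontinuous seminorm on it is continuous. **Theorem.**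 Let $(\mathfrak A,\mathfrak A_0)$ and $(\mathfrak B,\mathfrak B_0)$ be unital Banach quasi \*-algebras that are fully representable and satisfy condition (P), and let $\bar n$ be a uniform cross-norm on $\mathfrak A\otimes\mathfrak B$ such that $\mathfrak A\otimes_{\bar n}\mathfrak B$ is barrelled. Then $(\mathfrak A\otimes_{\bar n}\mathfrak B,\mathfrak A_0\otimes\mathfrak B_0)$ is fully representable. Moreover it is a normed quasi \*-algebra whenever its involution is isometric, that is, $\|c^*\|_{\bar n}=\|c\|_{\bar n}$ for all $c\in\mathfrak A\otimes\mathfrak B$. -/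

import Mathlib

open Filter Topology
open scoped TensorProduct ComplexOrder ComplexConjugate

universe u v w z

/-- A quasi *-algebra `(A, A₀)`: a complex vector space `A` with a conjugate-linear involution, and
a complex *-algebra `A₀` (not assumed unital) that is embedded in `A` as a subspace by `ι`, with
bilinear left and right multiplications of elements of `A` by elements of `A₀`, which extend the
multiplication of `A₀`. `lmul x a` is the product `x a` and `rmul a x` is the product `a x`. -/
structure QuasiStarAlgebra (A₀ : Type u) (A : Type v)
    [NonUnitalRing A₀] [StarRing A₀] [Module ℂ A₀] [IsScalarTower ℂ A₀ A₀]
    [SMulCommClass ℂ A₀ A₀] [StarModule ℂ A₀]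
    [AddCommGroup A] [Module ℂ A] [StarAddMonoid A] [StarModule ℂ A] where
  ι : A₀ →ₗ[ℂ] A
  ι_injective : Function.Injective ι
  lmul : A₀ →ₗ[ℂ] A →ₗ[ℂ] A
  rmul : A →ₗ[ℂ] A₀ →ₗ[ℂ] A
  lmul_ι : ∀ x y : A₀, lmul x (ι y) = ι (x * y)
  rmul_ι : ∀ x y : A₀, rmul (ι x) y = ι (x * y)
  rmul_lmul : ∀ (x y : A₀) (a : A), rmul (lmul x a) y = lmul x (rmul a y)
  rmul_mul : ∀ (x y : A₀) (a : A), rmul a (x * y) = rmul (rmul a x) y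
  star_ι : ∀ x : A₀, ι (star x) = star (ι x)
  star_rmul : ∀ (a : A) (x : A₀), star (rmul a x) = lmul (star x) (star a)
  star_lmul : ∀ (x : A₀) (a : A), star (lmul x a) = rmul (star a) (star x)

namespace QuasiStarAlgebra

section Algebraic

variable {A₀ : Type u} {A : Type v}
  [NonUnitalRing A₀] [StarRing A₀] [Module ℂ A₀] [IsScalarTower ℂ A₀ A₀]
  [SMulCommClass ℂ A₀ A₀] [StarModule ℂ A₀]
  [AddCommGroup A] [Module ℂ A] [StarAddMonoid A] [StarModule ℂ A]

/-- `(A, A₀)` has a unit: a unique `e ∈ A₀` with `a e = a = e a` for all `a ∈ A`. -/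
def IsUnital (Q : QuasiStarAlgebra A₀ A) : Prop :=
  ∃! e : A₀, ∀ a : A, Q.rmul a e = a ∧ Q.lmul e a = a

/-- Representable linear functionals: conditions (L.1), (L.2), (L.3). The order on `ℂ` is the usual
one: `0 ≤ c` says that `c` is real and non-negative. -/
structure IsRepresentable (Q : QuasiStarAlgebra A₀ A) (ω : A →ₗ[ℂ] ℂ) : Prop where
  nonneg : ∀ x : A₀, 0 ≤ ω (Q.ι (star x * x))
  hermitian : ∀ (x y : A₀) (a : A),
    ω (Q.lmul (star y) (Q.rmul (star a) x)) = conj (ω (Q.lmul (star x) (Q.rmul a y)))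
  bounded : ∀ a : A, ∃ γ : ℝ, 0 < γ ∧
    ∀ x : A₀, ‖ω (Q.rmul (star a) x)‖ ≤ γ * Real.sqrt (ω (Q.ι (star x * x))).re

/-- The form `φ_ω (x, y) = ω (y* x)` on `A₀ × A₀`. -/
def form (Q : QuasiStarAlgebra A₀ A) (ω : A →ₗ[ℂ] ℂ) (x y : A₀) : ℂ :=
  ω (Q.ι (star y * x))

/-- The set `A₀⁺` of finite sums of elements `x* x`, `x ∈ A₀`. -/
def positiveCore (_Q : QuasiStarAlgebra A₀ A) : Set A₀ :=
  {z | ∃ (n : ℕ) (x : Fin n → A₀), z = ∑ k, star (x k) * x k}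

end Algebraic

section Normed

variable {A₀ : Type u} {A : Type v}
  [NonUnitalRing A₀] [StarRing A₀] [Module ℂ A₀] [IsScalarTower ℂ A₀ A₀]
  [SMulCommClass ℂ A₀ A₀] [StarModule ℂ A₀]
  [NormedAddCommGroup A] [NormedSpace ℂ A] [StarAddMonoid A] [StarModule ℂ A]

/-- `(A, A₀)` is a normed quasi *-algebra for the norm of `A`. It is a Banach quasi *-algebra if
moreover `A` is complete. -/
structure IsNormed (Q : QuasiStarAlgebra A₀ A) : Prop where
  norm_star : ∀ a : A, ‖star a‖ = ‖a‖
  dense : DenseRange Q.ι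
  continuous_rmul : ∀ x : A₀, Continuous fun a : A => Q.rmul a x

/-- The set `R_c(A, A₀)` of continuous representable linear functionals. -/
def contRep (Q : QuasiStarAlgebra A₀ A) : Set (A →ₗ[ℂ] ℂ) :=
  {ω | Q.IsRepresentable ω ∧ Continuous ω}

/-- The cone `A⁺`: the norm closure of `A₀⁺` in `A`. -/
def positiveCone (Q : QuasiStarAlgebra A₀ A) : Set A :=
  closure (Q.ι '' Q.positiveCore)

/-- A sufficient family of positive linear functionals. -/
def IsSufficient (Q : QuasiStarAlgebra A₀ A) (F : Set (A →ₗ[ℂ] ℂ)) : Prop :=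
  (∀ ω ∈ F, ∀ a ∈ Q.positiveCone, 0 ≤ ω a) ∧
    ∀ a ∈ Q.positiveCone, a ≠ 0 → ∃ ω ∈ F, 0 < ω a

/-- The domain of the closure of `φ_ω`: the norm limits of sequences in `A₀` that are
Cauchy for `φ_ω`. -/
def formDomain (Q : QuasiStarAlgebra A₀ A) (ω : A →ₗ[ℂ] ℂ) : Set A :=
  {a | ∃ x : ℕ → A₀, Tendsto (fun n => Q.ι (x n)) atTop (𝓝 a) ∧
    Tendsto (fun p : ℕ × ℕ => Q.form ω (x p.1 - x p.2) (x p.1 - x p.2)) atTop (𝓝 0)}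

/-- `R_c(A, A₀)` is sufficient, and the intersection `A_R` of the domains of the closures of
`φ_ω`, `ω ∈ R_c(A, A₀)`, is all of `A`. -/
def IsFullyRepresentable (Q : QuasiStarAlgebra A₀ A) : Prop :=
  Q.IsSufficient Q.contRep ∧ ⋂ ω ∈ Q.contRep, Q.formDomain ω = Set.univ

/-- The positivity condition (P): if `ω (x* a x) ≥ 0` for all `ω ∈ R_c(A, A₀)` and all
`x ∈ A₀`, then `a ∈ A⁺`. -/
def ConditionP (Q : QuasiStarAlgebra A₀ A) : Prop :=
  ∀ a : A, (∀ ω ∈ Q.contRep, ∀ x : A₀, 0 ≤ ω (Q.lmul (star x) (Q.rmul a x))) →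
    a ∈ Q.positiveCone

end Normed

end QuasiStarAlgebra

/-- A uniform cross-norm on the algebraic tensor product of two normed spaces: a norm with
`‖a ⊗ b‖ = ‖a‖ ‖b‖` for which `T ⊗ S` is bounded with norm at most `‖T‖ ‖S‖`, for all bounded
linear operators `T` on `A` and `S` on `B`. -/
structure UniformCrossNorm (A : Type v) (B : Type w)
    [NormedAddCommGroup A] [NormedSpace ℂ A] [NormedAddCommGroup B] [NormedSpace ℂ B] where
  toSeminorm : Seminorm ℂ (A ⊗[ℂ] B)
  eq_zero_of_map_eq_zero : ∀ c : A ⊗[ℂ] B, toSeminorm c = 0 → c = 0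
  map_tmul : ∀ (a : A) (b : B), toSeminorm (a ⊗ₜ[ℂ] b) = ‖a‖ * ‖b‖
  map_map_le : ∀ (T : A →L[ℂ] A) (S : B →L[ℂ] B) (c : A ⊗[ℂ] B),
    toSeminorm (TensorProduct.map (T : A →ₗ[ℂ] A) (S : B →ₗ[ℂ] B) c) ≤
      ‖T‖ * ‖S‖ * toSeminorm c

section NormedTensor

variable {A : Type v} {B : Type w}
  [NormedAddCommGroup A] [NormedSpace ℂ A] [NormedAddCommGroup B] [NormedSpace ℂ B]

/-- The algebraic tensor product `A ⊗ B`, normed by the uniform cross-norm `n` (not completed). -/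
def NormedTensor (_n : UniformCrossNorm A B) : Type (max v w) := A ⊗[ℂ] B

noncomputable instance NormedTensor.instAddCommGroup (n : UniformCrossNorm A B) : AddCommGroup (NormedTensor n) :=
  inferInstanceAs (AddCommGroup (A ⊗[ℂ] B))

noncomputable instance NormedTensor.instModule (n : UniformCrossNorm A B) : Module ℂ (NormedTensor n) :=
  inferInstanceAs (Module ℂ (A ⊗[ℂ] B))

noncomputable instance NormedTensor.instNormedAddCommGroup (n : UniformCrossNorm A B) :
    NormedAddCommGroup (NormedTensor n) :=
  AddGroupNorm.toNormedAddCommGroup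
    { toFun := fun c => n.toSeminorm c
      map_zero' := map_zero n.toSeminorm
      add_le' := map_add_le_add n.toSeminorm
      neg' := map_neg_eq_map n.toSeminorm
      eq_zero_of_map_eq_zero' := n.eq_zero_of_map_eq_zero }

noncomputable instance NormedTensor.instNormedSpace (n : UniformCrossNorm A B) :
    NormedSpace ℂ (NormedTensor n) where
  norm_smul_le r c := (map_smul_eq_mul n.toSeminorm r c).le

noncomputable instance NormedTensor.instStarAddMonoid (n : UniformCrossNorm A B)
    [StarAddMonoid A] [StarModule ℂ A] [StarAddMonoid B] [StarModule ℂ B] : StarAddMonoid (NormedTensor n) :=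
  inferInstanceAs (StarAddMonoid (A ⊗[ℂ] B))

noncomputable instance NormedTensor.instStarModule (n : UniformCrossNorm A B)
    [StarAddMonoid A] [StarModule ℂ A] [StarAddMonoid B] [StarModule ℂ B] : StarModule ℂ (NormedTensor n) :=
  inferInstanceAs (StarModule ℂ (A ⊗[ℂ] B))

end NormedTensor

section TensorStarRing

variable {A₀ : Type u} {B₀ : Type z}
  [NonUnitalRing A₀] [StarRing A₀] [Module ℂ A₀] [IsScalarTower ℂ A₀ A₀]
  [SMulCommClass ℂ A₀ A₀] [StarModule ℂ A₀]
  [NonUnitalRing B₀] [StarRing B₀] [Module ℂ B₀] [IsScalarTower ℂ B₀ B₀]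
  [SMulCommClass ℂ B₀ B₀] [StarModule ℂ B₀]

/-- The tensor product of two *-algebras is a *-algebra. -/
noncomputable instance tensorStarRing : StarRing (A₀ ⊗[ℂ] B₀) where
  star_mul s t := by
    induction s with
    | zero => simp
    | add s₁ s₂ h₁ h₂ => rw [add_mul, star_add, h₁, h₂, star_add, mul_add]
    | tmul x y =>
      induction t with
      | zero => simp
      | add t₁ t₂ h₁ h₂ => rw [mul_add, star_add, h₁, h₂, star_add, add_mul]
      | tmul x' y' => simp [Algebra.TensorProduct.tmul_mul_tmul]
  star_add := star_add

end TensorStarRing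

namespace QuasiStarAlgebra

variable {A₀ : Type u} {A : Type v} {B₀ : Type z} {B : Type w}
  [NonUnitalRing A₀] [StarRing A₀] [Module ℂ A₀] [IsScalarTower ℂ A₀ A₀]
  [SMulCommClass ℂ A₀ A₀] [StarModule ℂ A₀]
  [NonUnitalRing B₀] [StarRing B₀] [Module ℂ B₀] [IsScalarTower ℂ B₀ B₀]
  [SMulCommClass ℂ B₀ B₀] [StarModule ℂ B₀]

section

variable
  [AddCommGroup A] [Module ℂ A] [StarAddMonoid A] [StarModule ℂ A]
  [AddCommGroup B] [Module ℂ B] [StarAddMonoid B] [StarModule ℂ B]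

/-- The tensor product quasi *-algebra `(A ⊗ B, A₀ ⊗ B₀)`, with
`(x ⊗ y)(a ⊗ b) = xa ⊗ yb`, `(a ⊗ b)(x ⊗ y) = ax ⊗ by` and `(a ⊗ b)* = a* ⊗ b*`. -/
noncomputable def tensor (Q : QuasiStarAlgebra A₀ A) (Q' : QuasiStarAlgebra B₀ B) :
    QuasiStarAlgebra (A₀ ⊗[ℂ] B₀) (A ⊗[ℂ] B) where
  ι := TensorProduct.map Q.ι Q'.ι
  ι_injective := TensorProduct.map_injective_of_flat_flat _ _ Q.ι_injective Q'.ι_injective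
  lmul := TensorProduct.map₂ Q.lmul Q'.lmul
  rmul := TensorProduct.map₂ Q.rmul Q'.rmul
  lmul_ι s t := by
    induction s with
    | zero => simp
    | add s₁ s₂ h₁ h₂ => simp only [map_add, LinearMap.add_apply, h₁, h₂, add_mul]
    | tmul x y =>
      induction t with
      | zero => simp
      | add t₁ t₂ h₁ h₂ => simp only [map_add, h₁, h₂, mul_add]
      | tmul x' y' => simp [Algebra.TensorProduct.tmul_mul_tmul, Q.lmul_ι, Q'.lmul_ι]
  rmul_ι s t := by
    induction s with
    | zero => simp
    | add s₁ s₂ h₁ h₂ => simp only [map_add, LinearMap.add_apply, h₁, h₂, add_mul]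
    | tmul x y =>
      induction t with
      | zero => simp
      | add t₁ t₂ h₁ h₂ => simp only [map_add, h₁, h₂, mul_add]
      | tmul x' y' => simp [Algebra.TensorProduct.tmul_mul_tmul, Q.rmul_ι, Q'.rmul_ι]
  rmul_lmul s t c := by
    induction c with
    | zero => simp
    | add c₁ c₂ h₁ h₂ => simp only [map_add, LinearMap.add_apply, h₁, h₂]
    | tmul a b =>
      induction s with
      | zero => simp
      | add s₁ s₂ h₁ h₂ => simp only [map_add, LinearMap.add_apply, h₁, h₂]
      | tmul x y =>
        induction t with
        | zero => simp
        | add t₁ t₂ h₁ h₂ => simp only [map_add, h₁, h₂]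
        | tmul x' y' => simp [Q.rmul_lmul, Q'.rmul_lmul]
  rmul_mul s t c := by
    induction c with
    | zero => simp
    | add c₁ c₂ h₁ h₂ => simp only [map_add, LinearMap.add_apply, h₁, h₂]
    | tmul a b =>
      induction s with
      | zero => simp
      | add s₁ s₂ h₁ h₂ => simp only [map_add, LinearMap.add_apply, h₁, h₂, add_mul]
      | tmul x y =>
        induction t with
        | zero => simp
        | add t₁ t₂ h₁ h₂ => simp only [map_add, h₁, h₂, mul_add]
        | tmul x' y' => simp [Algebra.TensorProduct.tmul_mul_tmul, Q.rmul_mul, Q'.rmul_mul]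
  star_ι s := by
    induction s with
    | zero => simp
    | add s₁ s₂ h₁ h₂ => simp only [map_add, star_add, h₁, h₂]
    | tmul x y => simp [Q.star_ι, Q'.star_ι]
  star_rmul c s := by
    induction c with
    | zero => simp
    | add c₁ c₂ h₁ h₂ => simp only [map_add, star_add, LinearMap.add_apply, h₁, h₂]
    | tmul a b =>
      induction s with
      | zero => simp
      | add s₁ s₂ h₁ h₂ => simp only [map_add, star_add, LinearMap.add_apply, h₁, h₂]
      | tmul x y => simp [Q.star_rmul, Q'.star_rmul]
  star_lmul s c := by
    induction c with
    | zero => simp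
    | add c₁ c₂ h₁ h₂ => simp only [map_add, star_add, LinearMap.add_apply, h₁, h₂]
    | tmul a b =>
      induction s with
      | zero => simp
      | add s₁ s₂ h₁ h₂ => simp only [map_add, star_add, LinearMap.add_apply, h₁, h₂]
      | tmul x y => simp [Q.star_lmul, Q'.star_lmul]

end

variable
  [NormedAddCommGroup A] [NormedSpace ℂ A] [StarAddMonoid A] [StarModule ℂ A]
  [NormedAddCommGroup B] [NormedSpace ℂ B] [StarAddMonoid B] [StarModule ℂ B]

/-- The tensor product quasi *-algebra, on the space `A ⊗ B` normed by `n`. -/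
noncomputable def normedTensor (Q : QuasiStarAlgebra A₀ A) (Q' : QuasiStarAlgebra B₀ B)
    (n : UniformCrossNorm A B) : QuasiStarAlgebra (A₀ ⊗[ℂ] B₀) (NormedTensor n) :=
  Q.tensor Q'

end QuasiStarAlgebra

/-! Sufficiency of `contRep` on the tensor product comes from product functionals `f ⊗ g`, and the
form domains from barrelledness.

On a factor, if every `ω` in `contRep` kills `a`, so do its translates, so (P) puts `a` in the
positive cone and sufficiency gives `a = 0`: `contRep` separates points. Products of separating
families separate the points of `A ⊗ B`, and a separating `contRep` is sufficient. Products are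
representable because Hadamard products of Gram matrices are positive (Schur) and monotone in the
Loewner order; they are continuous because the cross-norm is uniform, tested on rank-one operators.

For the domains, `p a = sup {|ω (s* a)| : φ_ω (s, s) ≤ 1}` is finite by (L.3), hence a continuous
seminorm on a barrelled space, and `φ_ω (x, x) ≤ p x ^ 2` on the core. So every norm-convergent
sequence of the core is Cauchy for `φ_ω`. -/

namespace Matrix

/-- Monotonicity of the Hadamard product for the Loewner order. -/
theorem PosSemidef.hadamard_sub_hadamard {ι : Type*} [Fintype ι] {P P' M M' : Matrix ι ι ℂ}
    (hP' : P'.PosSemidef) (hM : M.PosSemidef) (h : (P - M).PosSemidef)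
    (h' : (P' - M').PosSemidef) : (P.hadamard P' - M.hadamard M').PosSemidef := by
  have key : P.hadamard P' - M.hadamard M' =
      (P - M).hadamard P' + M.hadamard (P' - M') := by
    ext i j
    simp only [sub_apply, add_apply, hadamard_apply]
    ring
  rw [key]
  exact (h.hadamard hP').add (hM.hadamard h')

theorem PosSemidef.sum_nonneg {ι : Type*} [Fintype ι] {P : Matrix ι ι ℂ} (hP : P.PosSemidef) :
    0 ≤ ∑ i, ∑ j, P i j := by
  simpa [dotProduct, mulVec] using hP.dotProduct_mulVec_nonneg fun _ => 1

end Matrix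

namespace QuasiStarAlgebra

/-! ### Representable functionals and Gram matrices -/

section Algebraic

variable {A₀ : Type u} {A : Type v}
  [NonUnitalRing A₀] [StarRing A₀] [Module ℂ A₀] [IsScalarTower ℂ A₀ A₀]
  [SMulCommClass ℂ A₀ A₀] [StarModule ℂ A₀]
  [AddCommGroup A] [Module ℂ A] [StarAddMonoid A] [StarModule ℂ A]
  {Q : QuasiStarAlgebra A₀ A} {ω : A →ₗ[ℂ] ℂ} {e : A₀}

/-- The unit is not assumed self-adjoint, and (L.2) at `y = e` puts `star e` on the left. -/
theorem lmul_star_unit (he : ∀ a : A, Q.rmul a e = a ∧ Q.lmul e a = a) (a : A) :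
    Q.lmul (star e) a = a := by
  have h := Q.star_rmul (star a) e
  rw [(he _).1, star_star] at h
  exact h.symm

theorem lmul_mul (Q : QuasiStarAlgebra A₀ A) (x y : A₀) (a : A) :
    Q.lmul (x * y) a = Q.lmul x (Q.lmul y a) := by
  apply star_injective
  rw [Q.star_lmul, Q.star_lmul, Q.star_lmul, star_mul, Q.rmul_mul]

theorem IsRepresentable.rmul_star_eq_conj (hω : Q.IsRepresentable ω)
    (he : ∀ a : A, Q.rmul a e = a ∧ Q.lmul e a = a) (a : A) (x : A₀) :
    ω (Q.rmul (star a) x) = conj (ω (Q.lmul (star x) a)) := by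
  have h := hω.hermitian x e a
  rwa [lmul_star_unit he, (he a).1] at h

theorem IsRepresentable.form_conj_symm (hω : Q.IsRepresentable ω)
    (he : ∀ a : A, Q.rmul a e = a ∧ Q.lmul e a = a) (x y : A₀) :
    ω (Q.ι (star y * x)) = conj (ω (Q.ι (star x * y))) := by
  have h := hω.rmul_star_eq_conj he (Q.ι y) x
  rwa [← Q.star_ι, Q.rmul_ι, Q.lmul_ι] at h

theorem map_ι_star_sum_mul_sum (Q : QuasiStarAlgebra A₀ A) (ω : A →ₗ[ℂ] ℂ) {k : ℕ}
    (x : Fin k → A₀) (v : Fin k → ℂ) :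
    ω (Q.ι (star (∑ i, v i • x i) * ∑ i, v i • x i)) =
      ∑ i, ∑ j, conj (v i) * (ω (Q.ι (star (x i) * x j)) * v j) := by
  simp only [star_sum, star_smul, Finset.sum_mul, Finset.mul_sum, map_sum, smul_mul_assoc,
    mul_smul_comm, map_smul, smul_eq_mul]
  rw [Finset.sum_comm]
  refine Finset.sum_congr rfl fun i _ => Finset.sum_congr rfl fun j _ => ?_
  rw [RCLike.star_def]
  ring

/-- The quadratic form of the Gram matrix at `v` is `φ_ω (s, s)` with `s = ∑ v i • x i`. -/
theorem IsRepresentable.posSemidef_gram (hω : Q.IsRepresentable ω)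
    (he : ∀ a : A, Q.rmul a e = a ∧ Q.lmul e a = a) {k : ℕ} (x : Fin k → A₀) :
    (Matrix.of fun i j => ω (Q.ι (star (x i) * x j))).PosSemidef := by
  refine .of_dotProduct_mulVec_nonneg ?_ fun v => ?_
  · ext i j
    simpa using (hω.form_conj_symm he (x j) (x i)).symm
  · have h := hω.nonneg (∑ i, v i • x i)
    rw [map_ι_star_sum_mul_sum] at h
    simpa [dotProduct, Matrix.mulVec, Finset.mul_sum] using h

theorem IsRepresentable.ofReal_re (hω : Q.IsRepresentable ω) (x : A₀) :
    ((ω (Q.ι (star x * x))).re : ℂ) = ω (Q.ι (star x * x)) :=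
  (Complex.eq_re_of_ofReal_le (r := 0) (by simpa using hω.nonneg x)).symm

theorem IsRepresentable.re_nonneg (hω : Q.IsRepresentable ω) (x : A₀) :
    0 ≤ (ω (Q.ι (star x * x))).re :=
  (Complex.nonneg_iff.mp (hω.nonneg x)).1

/-- This is (L.3) in matrix form: squared and applied to all combinations `s = ∑ v i • x i`, it says
that `γ² φ_ω (s, s) - |ω (a* s)|²`, the quadratic form at `v`, is non-negative. -/
theorem IsRepresentable.posSemidef_smul_gram_sub (hω : Q.IsRepresentable ω)
    (he : ∀ a : A, Q.rmul a e = a ∧ Q.lmul e a = a) {a : A} {γ : ℝ}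
    (hγ : ∀ x : A₀, ‖ω (Q.rmul (star a) x)‖ ≤ γ * Real.sqrt (ω (Q.ι (star x * x))).re)
    {k : ℕ} (x : Fin k → A₀) :
    (((γ ^ 2 : ℝ) : ℂ) • (Matrix.of fun i j => ω (Q.ι (star (x i) * x j))) -
      Matrix.vecMulVec (star fun i => ω (Q.rmul (star a) (x i)))
        (fun i => ω (Q.rmul (star a) (x i)))).PosSemidef := by
  refine .of_dotProduct_mulVec_nonneg ?_ fun v => ?_
  · refine .sub ?_ (Matrix.posSemidef_vecMulVec_star_self _).isHermitian
    refine ((hω.posSemidef_gram he x).smul (a := ((γ ^ 2 : ℝ) : ℂ)) ?_).isHermitian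
    exact_mod_cast sq_nonneg γ
  · have h₁ := map_ι_star_sum_mul_sum Q ω x v
    have h₂ : ω (Q.rmul (star a) (∑ i, v i • x i)) = ∑ i, v i * ω (Q.rmul (star a) (x i)) := by
      simp
    set s := ∑ i, v i • x i
    have hs : ‖ω (Q.rmul (star a) s)‖ ^ 2 ≤ γ ^ 2 * (ω (Q.ι (star s * s))).re := by
      calc _ ≤ (γ * Real.sqrt (ω (Q.ι (star s * s))).re) ^ 2 :=
            pow_le_pow_left₀ (norm_nonneg _) (hγ s) 2
        _ = _ := by rw [mul_pow, Real.sq_sqrt (hω.re_nonneg s)]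
    have key : star v ⬝ᵥ (((γ ^ 2 : ℝ) : ℂ) • (Matrix.of fun i j => ω (Q.ι (star (x i) * x j))) -
        Matrix.vecMulVec (star fun i => ω (Q.rmul (star a) (x i)))
        (fun i => ω (Q.rmul (star a) (x i)))).mulVec v =
        ((γ ^ 2 * (ω (Q.ι (star s * s))).re - ‖ω (Q.rmul (star a) s)‖ ^ 2 : ℝ) : ℂ) := by
      have h₃ : ((‖ω (Q.rmul (star a) s)‖ ^ 2 : ℝ) : ℂ) =
          conj (ω (Q.rmul (star a) s)) * ω (Q.rmul (star a) s) := by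
        rw [Complex.conj_mul']; push_cast; rfl
      rw [Complex.ofReal_sub, h₃, Complex.ofReal_mul, hω.ofReal_re, h₁, h₂, map_sum,
        Finset.sum_mul_sum, Finset.mul_sum, ← Finset.sum_sub_distrib]
      simp only [dotProduct, Matrix.mulVec, Matrix.sub_apply, Matrix.smul_apply, Matrix.of_apply,
        Matrix.vecMulVec_apply, Pi.star_apply, RCLike.star_def, smul_eq_mul, Finset.mul_sum,
        map_mul, ← Finset.sum_sub_distrib]
      refine Finset.sum_congr rfl fun i _ => Finset.sum_congr rfl fun j _ => ?_
      ring
    rw [key]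
    exact_mod_cast sub_nonneg.mpr hs

/-- Translates `a ↦ ω (y* a y)` of representable functionals are representable. -/
theorem IsRepresentable.translate (hω : Q.IsRepresentable ω) (y : A₀) :
    Q.IsRepresentable (ω ∘ₗ Q.lmul (star y) ∘ₗ Q.rmul.flip y) where
  nonneg x := by
    have h := hω.nonneg (x * y)
    simpa [Q.rmul_ι, Q.lmul_ι, star_mul, mul_assoc] using h
  hermitian x z a := by
    have h := hω.hermitian (x * y) (z * y) a
    simpa [star_mul, lmul_mul, Q.rmul_mul, Q.rmul_lmul] using h
  bounded a := by
    -- Since `y* (a* x) y = (a y)* (x y)`, the constant of `ω` at `a y` serves the translate at `a`.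
    obtain ⟨γ, hγ, h⟩ := hω.bounded (Q.rmul a y)
    refine ⟨γ, hγ, fun x => ?_⟩
    have h' := h (x * y)
    rw [Q.star_rmul, Q.rmul_mul, Q.rmul_lmul, Q.rmul_lmul] at h'
    simpa [Q.rmul_ι, Q.lmul_ι, star_mul, mul_assoc] using h'

end Algebraic

/-! ### Separation of points; forms on barrelled spaces -/

section Normed

variable {A₀ : Type u} {A : Type v}
  [NonUnitalRing A₀] [StarRing A₀] [Module ℂ A₀] [IsScalarTower ℂ A₀ A₀]
  [SMulCommClass ℂ A₀ A₀] [StarModule ℂ A₀]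
  [NormedAddCommGroup A] [NormedSpace ℂ A] [StarAddMonoid A] [StarModule ℂ A]
  {Q : QuasiStarAlgebra A₀ A} {ω : A →ₗ[ℂ] ℂ} {e : A₀}

/-- Left multiplication is right multiplication conjugated by the isometric involution. -/
theorem IsNormed.continuous_lmul (hQ : Q.IsNormed) (x : A₀) :
    Continuous fun a : A => Q.lmul x a := by
  have hs : Continuous (star : A → A) :=
    AddMonoidHomClass.continuous_of_bound (starAddEquiv : A ≃+ A) 1 fun a => by
      simpa using (hQ.norm_star a).le
  have h : (fun a : A => Q.lmul x a) = fun a => star (Q.rmul (star a) (star x)) := by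
    funext a
    rw [Q.star_rmul, star_star, star_star]
  rw [h]
  exact hs.comp ((hQ.continuous_rmul (star x)).comp hs)

theorem IsNormed.translate_mem_contRep (hQ : Q.IsNormed) (hω : ω ∈ Q.contRep) (y : A₀) :
    ω ∘ₗ Q.lmul (star y) ∘ₗ Q.rmul.flip y ∈ Q.contRep :=
  ⟨hω.1.translate y, hω.2.comp ((hQ.continuous_lmul _).comp (hQ.continuous_rmul y))⟩

/-- Under condition (P), a sufficient family of continuous representable functionals separates
points. -/
theorem eq_zero_of_forall_contRep (hQ : Q.IsNormed) (hs : Q.IsSufficient Q.contRep)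
    (hP : Q.ConditionP) {a : A} (h : ∀ ω ∈ Q.contRep, ω a = 0) : a = 0 := by
  by_contra ha
  have hpos : a ∈ Q.positiveCone := hP a fun ω hω x =>
    (h _ (hQ.translate_mem_contRep hω x)).ge
  obtain ⟨ω, hω, hlt⟩ := hs.2 a hpos ha
  exact hlt.ne' (h ω hω)

theorem nonneg_of_mem_positiveCone (hω : ω ∈ Q.contRep) {a : A} (ha : a ∈ Q.positiveCone) :
    0 ≤ ω a := by
  have hcl : IsClosed {a : A | 0 ≤ ω a} := isClosed_Ici.preimage hω.2
  refine closure_minimal ?_ hcl ha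
  rintro _ ⟨_, ⟨k, x, rfl⟩, rfl⟩
  simp only [Set.mem_ofPred_eq, map_sum]
  exact Finset.sum_nonneg fun i _ => hω.1.nonneg (x i)

/-- Non-negativity on the cone is automatic by continuity, so there "not positive" means "zero". -/
theorem isSufficient_contRep_of_separating
    (h : ∀ a : A, (∀ ω ∈ Q.contRep, ω a = 0) → a = 0) : Q.IsSufficient Q.contRep := by
  refine ⟨fun ω hω a ha => nonneg_of_mem_positiveCone hω ha, fun a ha ha0 => ?_⟩
  by_contra! hne
  refine ha0 (h a fun ω hω => ?_)
  exact ((nonneg_of_mem_positiveCone hω ha).eq_of_not_lt (hne ω hω)).symm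

/-- On a barrelled space, the form of a continuous representable functional is bounded. -/
theorem exists_continuous_seminorm_form_le [BarrelledSpace ℂ A] (hω : ω ∈ Q.contRep)
    (he : ∀ a : A, Q.rmul a e = a ∧ Q.lmul e a = a)
    (hl : ∀ x : A₀, Continuous fun a : A => Q.lmul x a) :
    ∃ p : Seminorm ℂ A, Continuous p ∧ ∀ x : A₀, ‖Q.form ω x x‖ ≤ p (Q.ι x) ^ 2 := by
  -- The seminorms `a ↦ |ω (s* a)|` are indexed by the unit ball of `φ_ω`; (L.3) bounds them at `a`
  -- by `γ`.
  let I := {s : A₀ // (ω (Q.ι (star s * s))).re ≤ 1}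
  let q : I → Seminorm ℂ A := fun s => (normSeminorm ℂ ℂ).comp (ω ∘ₗ Q.lmul (star s.1))
  have hq : ∀ s a, q s a = ‖ω (Q.lmul (star s.1) a)‖ := fun s a => rfl
  have hcont : ∀ s, Continuous (q s) := fun s => (hω.2.comp (hl _)).norm
  have hbdd : BddAbove (Set.range q) := by
    rw [Seminorm.bddAbove_range_iff]
    intro a
    obtain ⟨γ, hγ, h⟩ := hω.1.bounded a
    refine ⟨γ, ?_⟩
    rintro _ ⟨s, rfl⟩
    have h' := h s.1
    rw [hω.1.rmul_star_eq_conj he, RCLike.norm_conj] at h'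
    refine (hq s a).le.trans (h'.trans ?_)
    exact mul_le_of_le_one_right hγ.le (Real.sqrt_le_one.mpr s.2)
  refine ⟨⨆ s, q s, ?_, fun x => ?_⟩
  · rw [Seminorm.coe_iSup_eq hbdd]
    exact Seminorm.continuous_iSup q hcont hbdd
  have hle : ∀ s : I, ‖ω (Q.lmul (star s.1) (Q.ι x))‖ ≤ (⨆ s, q s) (Q.ι x) := fun s =>
    (le_ciSup hbdd s : q s ≤ ⨆ s, q s) (Q.ι x)
  have hre := hω.1.re_nonneg x
  have hnorm : ‖Q.form ω x x‖ = (ω (Q.ι (star x * x))).re := by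
    rw [form, ← hω.1.ofReal_re, Complex.norm_real, Real.norm_of_nonneg hre, Complex.ofReal_re]
  rw [hnorm]
  -- A vector with `φ_ω (x, x) = 0` cannot be normalised, but then the bound is trivial.
  rcases hre.eq_or_lt with h0 | hpos
  · rw [← h0]; positivity
  set r := Real.sqrt (ω (Q.ι (star x * x))).re with hr
  have hr0 : 0 < r := Real.sqrt_pos.mpr hpos
  have hrr : (ω (Q.ι (star x * x))).re = r ^ 2 := (Real.sq_sqrt hre).symm
  have hω' : ω (Q.ι (star x * x)) = ((r ^ 2 : ℝ) : ℂ) := by rw [← hrr, hω.1.ofReal_re]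
  -- The supremum is tested at `s = x / r`, where `ω (s* x) = r² / r = r`.
  have hs : (ω (Q.ι (star (((r⁻¹ : ℝ) : ℂ) • x) * (((r⁻¹ : ℝ) : ℂ) • x)))).re ≤ 1 := by
    rw [star_smul, smul_mul_assoc, mul_smul_comm, map_smul, map_smul, map_smul, map_smul, hω',
      RCLike.star_def, Complex.conj_ofReal, smul_eq_mul, smul_eq_mul, ← Complex.ofReal_mul,
      ← Complex.ofReal_mul, Complex.ofReal_re]
    refine le_of_eq ?_
    field_simp
  have h := hle ⟨_, hs⟩
  rw [Q.lmul_ι, star_smul, smul_mul_assoc, map_smul, map_smul, hω', RCLike.star_def,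
    Complex.conj_ofReal, smul_eq_mul, ← Complex.ofReal_mul, Complex.norm_real,
    Real.norm_of_nonneg (by positivity)] at h
  have h' : r ≤ (⨆ s, q s) (Q.ι x) := by
    refine le_trans (le_of_eq ?_) h
    field_simp
  rw [hrr]
  exact pow_le_pow_left₀ hr0.le h' 2

theorem formDomain_eq_univ [BarrelledSpace ℂ A] (hω : ω ∈ Q.contRep)
    (he : ∀ a : A, Q.rmul a e = a ∧ Q.lmul e a = a)
    (hl : ∀ x : A₀, Continuous fun a : A => Q.lmul x a) (hd : DenseRange Q.ι) :
    Q.formDomain ω = Set.univ := by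
  refine Set.eq_univ_of_forall fun a => ?_
  obtain ⟨p, hp, hle⟩ := exists_continuous_seminorm_form_le hω he hl
  obtain ⟨u, hu, hua⟩ := mem_closure_iff_seq_limit.mp (hd a)
  choose x hx using hu
  have hxa : Tendsto (fun n => Q.ι (x n)) atTop (𝓝 a) := by simpa only [hx] using hua
  refine ⟨x, hxa, squeeze_zero_norm (fun k => hle _) ?_⟩
  have h₁ : Tendsto (fun k : ℕ × ℕ => Q.ι (x k.1) - Q.ι (x k.2)) atTop (𝓝 (a - a)) := by
    rw [← prod_atTop_atTop_eq]
    exact (hxa.comp tendsto_fst).sub (hxa.comp tendsto_snd)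
  have h₂ := ((hp.pow 2).tendsto (a - a)).comp h₁
  simpa [Function.comp_def] using h₂

end Normed

section Tensor

variable {A₀ : Type u} {A : Type v} {B₀ : Type z} {B : Type w}
  [NonUnitalRing A₀] [StarRing A₀] [Module ℂ A₀] [IsScalarTower ℂ A₀ A₀]
  [SMulCommClass ℂ A₀ A₀] [StarModule ℂ A₀]
  [NonUnitalRing B₀] [StarRing B₀] [Module ℂ B₀] [IsScalarTower ℂ B₀ B₀]
  [SMulCommClass ℂ B₀ B₀] [StarModule ℂ B₀]

/-! ### Products of representable functionals -/

section Algebraic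

variable
  [AddCommGroup A] [Module ℂ A] [StarAddMonoid A] [StarModule ℂ A]
  [AddCommGroup B] [Module ℂ B] [StarAddMonoid B] [StarModule ℂ B]
  {Q : QuasiStarAlgebra A₀ A} {Q' : QuasiStarAlgebra B₀ B}
  {f : A →ₗ[ℂ] ℂ} {g : B →ₗ[ℂ] ℂ} {e : A₀} {e' : B₀}

theorem tensor_unit (he : ∀ a : A, Q.rmul a e = a ∧ Q.lmul e a = a)
    (he' : ∀ b : B, Q'.rmul b e' = b ∧ Q'.lmul e' b = b) (c : A ⊗[ℂ] B) :
    (Q.tensor Q').rmul c (e ⊗ₜ e') = c ∧ (Q.tensor Q').lmul (e ⊗ₜ e') c = c := by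
  induction c with
  | zero => simp
  | add c d hc hd =>
    simp only [map_add, LinearMap.add_apply]
    rw [hc.1, hd.1, hc.2, hd.2]
    exact ⟨rfl, rfl⟩
  | tmul a b => simp [tensor, he a, he' b]

theorem dualDistrib_tensor_form (Q : QuasiStarAlgebra A₀ A) (Q' : QuasiStarAlgebra B₀ B)
    (f : A →ₗ[ℂ] ℂ) (g : B →ₗ[ℂ] ℂ) {k : ℕ} (x : Fin k → A₀) (y : Fin k → B₀) :
    TensorProduct.dualDistrib ℂ A B (f ⊗ₜ g)
        ((Q.tensor Q').ι (star (∑ i, x i ⊗ₜ[ℂ] y i) * ∑ i, x i ⊗ₜ[ℂ] y i)) =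
      ∑ i, ∑ j, f (Q.ι (star (x i) * x j)) * g (Q'.ι (star (y i) * y j)) := by
  simp [tensor, star_sum, Finset.sum_mul, Finset.mul_sum, Algebra.TensorProduct.tmul_mul_tmul]
  rw [Finset.sum_comm]

theorem dualDistrib_lmul_rmul (hf : Q.IsRepresentable f) (hg : Q'.IsRepresentable g)
    (s t : A₀ ⊗[ℂ] B₀) (c : A ⊗[ℂ] B) :
    TensorProduct.dualDistrib ℂ A B (f ⊗ₜ g)
        ((Q.tensor Q').lmul (star t) ((Q.tensor Q').rmul (star c) s)) =
      conj (TensorProduct.dualDistrib ℂ A B (f ⊗ₜ g)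
        ((Q.tensor Q').lmul (star s) ((Q.tensor Q').rmul c t))) := by
  induction c with
  | zero => simp
  | add c₁ c₂ h₁ h₂ => simp only [map_add, star_add, LinearMap.add_apply, h₁, h₂]
  | tmul a b =>
    induction s with
    | zero => simp
    | add s₁ s₂ h₁ h₂ => simp only [map_add, star_add, LinearMap.add_apply, h₁, h₂]
    | tmul x y =>
      induction t with
      | zero => simp
      | add t₁ t₂ h₁ h₂ => simp only [map_add, star_add, LinearMap.add_apply, h₁, h₂]
      | tmul x' y' => simp [tensor, hf.hermitian, hg.hermitian]

/-- For `s = ∑ x i ⊗ y i` the value is the sum of the entries of the Hadamard product of two Gram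
matrices, positive by Schur's theorem. -/
theorem dualDistrib_form_nonneg (hf : Q.IsRepresentable f) (hg : Q'.IsRepresentable g)
    (he : ∀ a : A, Q.rmul a e = a ∧ Q.lmul e a = a)
    (he' : ∀ b : B, Q'.rmul b e' = b ∧ Q'.lmul e' b = b) (s : A₀ ⊗[ℂ] B₀) :
    0 ≤ TensorProduct.dualDistrib ℂ A B (f ⊗ₜ g) ((Q.tensor Q').ι (star s * s)) := by
  obtain ⟨k, x, y, rfl⟩ := TensorProduct.exists_sum_tmul_eq s
  rw [dualDistrib_tensor_form]
  simpa using ((hf.posSemidef_gram he x).hadamard (hg.posSemidef_gram he' y)).sum_nonneg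

theorem dualDistrib_rmul_tmul_bounded (hf : Q.IsRepresentable f) (hg : Q'.IsRepresentable g)
    (he : ∀ a : A, Q.rmul a e = a ∧ Q.lmul e a = a)
    (he' : ∀ b : B, Q'.rmul b e' = b ∧ Q'.lmul e' b = b) (a : A) (b : B) :
    ∃ γ : ℝ, 0 < γ ∧ ∀ s : A₀ ⊗[ℂ] B₀,
      ‖TensorProduct.dualDistrib ℂ A B (f ⊗ₜ g) ((Q.tensor Q').rmul (star (a ⊗ₜ[ℂ] b)) s)‖ ≤
        γ * Real.sqrt
          (TensorProduct.dualDistrib ℂ A B (f ⊗ₜ g) ((Q.tensor Q').ι (star s * s))).re := by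
  obtain ⟨γ, hγ, h⟩ := hf.bounded a
  obtain ⟨γ', hγ', h'⟩ := hg.bounded b
  refine ⟨γ * γ', mul_pos hγ hγ', fun s => ?_⟩
  have hnn := dualDistrib_form_nonneg hf hg he he' s
  obtain ⟨k, x, y, rfl⟩ := TensorProduct.exists_sum_tmul_eq s
  have hL : TensorProduct.dualDistrib ℂ A B (f ⊗ₜ g)
      ((Q.tensor Q').rmul (star (a ⊗ₜ[ℂ] b)) (∑ i, x i ⊗ₜ[ℂ] y i)) =
      ∑ i, f (Q.rmul (star a) (x i)) * g (Q'.rmul (star b) (y i)) := by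
    simp [tensor]
  have hsc : ((γ' ^ 2 : ℝ) : ℂ) ≥ 0 := by exact_mod_cast sq_nonneg γ'
  -- With Gram matrices `G`, `G'` and row vectors `v`, `w` of values, `γ² G ≥ v* v` and `γ'² G' ≥ w*
  -- w` multiply entrywise; summing all entries gives `|z|² ≤ (γ γ')² φ (s, s)`.
  have key := ((((hg.posSemidef_gram he' y).smul hsc).hadamard_sub_hadamard
    (Matrix.posSemidef_vecMulVec_star_self fun i => f (Q.rmul (star a) (x i)))
    (hf.posSemidef_smul_gram_sub he h x) (hg.posSemidef_smul_gram_sub he' h' y))).sum_nonneg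
  rw [dualDistrib_tensor_form] at hnn
  rw [hL, dualDistrib_tensor_form]
  set z := ∑ i, f (Q.rmul (star a) (x i)) * g (Q'.rmul (star b) (y i)) with hz
  set w := ∑ i, ∑ j, f (Q.ι (star (x i) * x j)) * g (Q'.ι (star (y i) * y j)) with hw
  have hsum : (((γ * γ') ^ 2 : ℝ) : ℂ) * w - conj z * z =
      ((((γ * γ') ^ 2 * w.re - ‖z‖ ^ 2 : ℝ)) : ℂ) := by
    rw [Complex.conj_mul', Complex.eq_re_of_ofReal_le (r := 0) (z := w) (by simpa using hnn)]
    push_cast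
    simp
  have key' : (0 : ℂ) ≤ (((γ * γ') ^ 2 * w.re - ‖z‖ ^ 2 : ℝ) : ℂ) := by
    rw [← hsum, hz, hw, map_sum, Finset.sum_mul_sum, Finset.mul_sum, ← Finset.sum_sub_distrib]
    simp only [Finset.mul_sum, ← Finset.sum_sub_distrib]
    refine key.trans_eq (Finset.sum_congr rfl fun i _ => Finset.sum_congr rfl fun j _ => ?_)
    simp only [Matrix.sub_apply, Matrix.hadamard_apply, Matrix.smul_apply, Matrix.of_apply,
      Matrix.vecMulVec_apply, Pi.star_apply, RCLike.star_def, smul_eq_mul, map_mul]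
    push_cast
    ring
  have hle : ‖z‖ ^ 2 ≤ (γ * γ') ^ 2 * w.re := sub_nonneg.mp (by exact_mod_cast key')
  calc ‖z‖ ≤ Real.sqrt ((γ * γ') ^ 2 * w.re) := Real.le_sqrt_of_sq_le hle
    _ = γ * γ' * Real.sqrt w.re := by
      rw [Real.sqrt_mul (sq_nonneg _), Real.sqrt_sq (by positivity)]

theorem IsRepresentable.dualDistrib (hf : Q.IsRepresentable f) (hg : Q'.IsRepresentable g)
    (he : ∀ a : A, Q.rmul a e = a ∧ Q.lmul e a = a)
    (he' : ∀ b : B, Q'.rmul b e' = b ∧ Q'.lmul e' b = b) :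
    (Q.tensor Q').IsRepresentable (TensorProduct.dualDistrib ℂ A B (f ⊗ₜ g)) where
  nonneg := dualDistrib_form_nonneg hf hg he he'
  hermitian := dualDistrib_lmul_rmul hf hg
  bounded c := by
    induction c with
    | zero => exact ⟨1, one_pos, fun s => by simp⟩
    | tmul a b => exact dualDistrib_rmul_tmul_bounded hf hg he he' a b
    -- The square root does not depend on `c`, so the constants add.
    | add c d hc hd =>
      obtain ⟨γ, hγ, h⟩ := hc
      obtain ⟨δ, hδ, h'⟩ := hd
      refine ⟨γ + δ, add_pos hγ hδ, fun s => ?_⟩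
      rw [star_add, map_add, LinearMap.add_apply, map_add, add_mul]
      exact (norm_add_le _ _).trans (add_le_add (h s) (h' s))

end Algebraic

/-! ### Product functionals: continuity and separation -/

section Normed

variable
  [NormedAddCommGroup A] [NormedSpace ℂ A] [NormedAddCommGroup B] [NormedSpace ℂ B]

/-- The rank-one operators `f(·) a` and `g(·) b` send `c` to `(f ⊗ g)(c) • (a ⊗ b)`; uniformity and
division by `‖a‖ ‖b‖` give the bound. -/
theorem _root_.UniformCrossNorm.norm_dualDistrib_le (n : UniformCrossNorm A B)
    (f : A →L[ℂ] ℂ) (g : B →L[ℂ] ℂ) (c : A ⊗[ℂ] B) :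
    ‖TensorProduct.dualDistrib ℂ A B ((f : A →ₗ[ℂ] ℂ) ⊗ₜ (g : B →ₗ[ℂ] ℂ)) c‖ ≤
      ‖f‖ * ‖g‖ * n.toSeminorm c := by
  -- Nonzero `a` and `b` are missing only if a factor is trivial, and then `c = 0`.
  have htriv : c = 0 ∨ ∃ a : A, ∃ b : B, a ≠ 0 ∧ b ≠ 0 := by
    by_contra! h
    have h0 : ∀ d : A ⊗[ℂ] B, d = 0 := fun d => by
      induction d with
      | zero => rfl
      | add d d' hd hd' => rw [hd, hd', add_zero]
      | tmul a b =>
        by_cases ha : a = 0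
        · rw [ha, TensorProduct.zero_tmul]
        · rw [h.2 a b ha, TensorProduct.tmul_zero]
    exact h.1 (h0 c)
  rcases htriv with rfl | ⟨a, b, ha, hb⟩
  · simp
  have h := n.map_map_le (f.smulRight a) (g.smulRight b) c
  have hc : ∀ c, TensorProduct.map ((f.smulRight a : A →L[ℂ] A) : A →ₗ[ℂ] A)
      ((g.smulRight b : B →L[ℂ] B) : B →ₗ[ℂ] B) c =
      TensorProduct.dualDistrib ℂ A B ((f : A →ₗ[ℂ] ℂ) ⊗ₜ (g : B →ₗ[ℂ] ℂ)) c • (a ⊗ₜ b) := by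
    intro c
    induction c with
    | zero => simp
    | add c d hc hd => rw [map_add, map_add, add_smul, hc, hd]
    | tmul x y =>
      simp only [TensorProduct.map_tmul, ContinuousLinearMap.coe_coe,
        ContinuousLinearMap.smulRight_apply, TensorProduct.smul_tmul_smul,
        TensorProduct.dualDistrib_apply]
  rw [hc, map_smul_eq_mul, n.map_tmul, ContinuousLinearMap.norm_smulRight_apply,
    ContinuousLinearMap.norm_smulRight_apply] at h
  have hab : 0 < ‖a‖ * ‖b‖ := mul_pos (norm_pos_iff.mpr ha) (norm_pos_iff.mpr hb)
  refine le_of_mul_le_mul_right (h.trans (le_of_eq ?_)) hab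
  ring

/-- Functionals that are products of members of point-separating families separate the points of
the tensor product. -/
theorem _root_.TensorProduct.eq_zero_of_forall_dualDistrib {F : Set (A →ₗ[ℂ] ℂ)}
    {G : Set (B →ₗ[ℂ] ℂ)} (hF : ∀ a, (∀ f ∈ F, f a = 0) → a = 0)
    (hG : ∀ b, (∀ g ∈ G, g b = 0) → b = 0) {c : A ⊗[ℂ] B}
    (h : ∀ f ∈ F, ∀ g ∈ G, TensorProduct.dualDistrib ℂ A B (f ⊗ₜ g) c = 0) : c = 0 := by
  have hr : ∀ (f : A →ₗ[ℂ] ℂ) (g : B →ₗ[ℂ] ℂ) (c : A ⊗[ℂ] B),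
      f (TensorProduct.rid ℂ A (g.lTensor A c)) = TensorProduct.dualDistrib ℂ A B (f ⊗ₜ g) c := by
    intro f g c
    induction c with
    | zero => simp
    | add c d hc hd => simp only [map_add, hc, hd]
    | tmul a b => simp [mul_comm]
  have hl : ∀ (f : A →ₗ[ℂ] ℂ) (g : B →ₗ[ℂ] ℂ) (c : A ⊗[ℂ] B),
      g (TensorProduct.lid ℂ B (f.rTensor B c)) = TensorProduct.dualDistrib ℂ A B (f ⊗ₜ g) c := by
    intro f g c
    induction c with
    | zero => simp
    | add c d hc hd => simp only [map_add, hc, hd]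
    | tmul a b => simp
  -- Contracting `c` with `g` gives a vector of `A` killed by `F`, hence zero, so `f` may be
  -- arbitrary.
  have h₁ : ∀ f : A →ₗ[ℂ] ℂ, ∀ g ∈ G, TensorProduct.dualDistrib ℂ A B (f ⊗ₜ g) c = 0 := by
    intro f g hg
    rw [← hr, hF (TensorProduct.rid ℂ A (g.lTensor A c)) fun f hf => by rw [hr, h f hf g hg],
      map_zero]
  have h₂ : ∀ f : A →ₗ[ℂ] ℂ, f.rTensor B c = 0 := by
    intro f
    apply (TensorProduct.lid ℂ B).injective
    rw [map_zero]
    exact hG _ fun g hg => by rw [hl, h₁ f g hg]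
  classical
  let 𝓑 := Module.Basis.ofVectorSpace ℂ A
  -- The coordinates of `c` along a basis of `A` are its contractions with the coordinate
  -- functionals.
  apply (TensorProduct.equivFinsuppOfBasisLeft (N := B) 𝓑).injective
  ext i
  rw [TensorProduct.equivFinsuppOfBasisLeft_apply, h₂]
  simp

theorem _root_.NormedTensor.continuous_map (n : UniformCrossNorm A B) (T : A →L[ℂ] A)
    (S : B →L[ℂ] B) :
    Continuous (X := NormedTensor n) (Y := NormedTensor n)
      (TensorProduct.map (T : A →ₗ[ℂ] A) (S : B →ₗ[ℂ] B)) :=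
  let F : NormedTensor n →ₗ[ℂ] NormedTensor n :=
    TensorProduct.map (T : A →ₗ[ℂ] A) (S : B →ₗ[ℂ] B)
  AddMonoidHomClass.continuous_of_bound F (‖T‖ * ‖S‖) (n.map_map_le T S)

end Normed

/-! ### Continuity and density in the normed tensor product -/

section NormedTensor

variable
  [NormedAddCommGroup A] [NormedSpace ℂ A] [StarAddMonoid A] [StarModule ℂ A]
  [NormedAddCommGroup B] [NormedSpace ℂ B] [StarAddMonoid B] [StarModule ℂ B]
  {Q : QuasiStarAlgebra A₀ A} {Q' : QuasiStarAlgebra B₀ B} {n : UniformCrossNorm A B}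

theorem continuous_normedTensor_lmul (hQ : Q.IsNormed) (hQ' : Q'.IsNormed)
    (s : A₀ ⊗[ℂ] B₀) : Continuous fun c : NormedTensor n => (Q.normedTensor Q' n).lmul s c := by
  induction s with
  | zero => simpa using continuous_const
  | add s t hs ht => simpa using! hs.add ht
  | tmul x y =>
    exact NormedTensor.continuous_map n ⟨Q.lmul x, hQ.continuous_lmul x⟩
      ⟨Q'.lmul y, hQ'.continuous_lmul y⟩

theorem continuous_normedTensor_rmul (hQ : Q.IsNormed) (hQ' : Q'.IsNormed)
    (s : A₀ ⊗[ℂ] B₀) : Continuous fun c : NormedTensor n => (Q.normedTensor Q' n).rmul c s := by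
  induction s with
  | zero => simpa using continuous_const
  | add s t hs ht => simpa using! hs.add ht
  | tmul x y =>
    have h := NormedTensor.continuous_map n ⟨Q.rmul.flip x, hQ.continuous_rmul x⟩
      ⟨Q'.rmul.flip y, hQ'.continuous_rmul y⟩
    refine h.congr fun (c : A ⊗[ℂ] B) => ?_
    change TensorProduct.map (Q.rmul.flip x) (Q'.rmul.flip y) c = (Q.tensor Q').rmul c (x ⊗ₜ y)
    induction c with
    | zero => simp
    | add c d hc hd => rw [map_add, map_add, LinearMap.add_apply, hc, hd]
    | tmul a b => simp [tensor]

/-- The cross-norm makes `a ⊗ b` continuous in each variable, so the closed span of the core absorbs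
first `b`, then `a`. -/
theorem denseRange_normedTensor_ι (hd : DenseRange Q.ι) (hd' : DenseRange Q'.ι) :
    DenseRange (Q.normedTensor Q' n).ι := by
  let M : Submodule ℂ (NormedTensor n) :=
    (LinearMap.range (Q.normedTensor Q' n).ι).topologicalClosure
  have hsub : ∀ s, (Q.normedTensor Q' n).ι s ∈ M := fun s =>
    Submodule.le_topologicalClosure _ ⟨s, rfl⟩
  have hcl : IsClosed (M : Set (NormedTensor n)) := Submodule.isClosed_topologicalClosure _
  let m : A →ₗ[ℂ] B →ₗ[ℂ] NormedTensor n := TensorProduct.mk ℂ A B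
  have hl : ∀ b : B, Continuous fun a : A => m a b := fun b =>
    AddMonoidHomClass.continuous_of_bound (m.flip b) ‖b‖ fun a =>
      ((n.map_tmul a b).trans (mul_comm _ _)).le
  have hr : ∀ a : A, Continuous fun b : B => m a b := fun a =>
    AddMonoidHomClass.continuous_of_bound (m a) ‖a‖ fun b => (n.map_tmul a b).le
  have h₁ : ∀ (x : A₀) (b : B), m (Q.ι x) b ∈ M := fun x b =>
    hd'.induction_on (p := fun b => m (Q.ι x) b ∈ M) b
      (hcl.preimage (hr _)) fun y => hsub (x ⊗ₜ y)
  have h₂ : ∀ (a : A) (b : B), m a b ∈ M := fun a b =>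
    hd.induction_on (p := fun a => m a b ∈ M) a
      (hcl.preimage (hl _)) fun x => h₁ x b
  intro c
  change c ∈ M
  induction c using TensorProduct.induction_on with
  | zero => exact M.zero_mem
  | add c d hc hd => exact M.add_mem hc hd
  | tmul a b => exact h₂ a b

theorem dualDistrib_mem_contRep {f : A →ₗ[ℂ] ℂ} {g : B →ₗ[ℂ] ℂ} {e : A₀} {e' : B₀}
    (hf : f ∈ Q.contRep) (hg : g ∈ Q'.contRep)
    (he : ∀ a : A, Q.rmul a e = a ∧ Q.lmul e a = a)
    (he' : ∀ b : B, Q'.rmul b e' = b ∧ Q'.lmul e' b = b) :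
    (TensorProduct.dualDistrib ℂ A B (f ⊗ₜ g) : NormedTensor n →ₗ[ℂ] ℂ) ∈
      (Q.normedTensor Q' n).contRep := by
  obtain ⟨h₁, h₂, h₃⟩ := hf.1.dualDistrib hg.1 he he'
  let F : NormedTensor n →ₗ[ℂ] ℂ := TensorProduct.dualDistrib ℂ A B (f ⊗ₜ g)
  exact ⟨⟨h₁, h₂, h₃⟩, AddMonoidHomClass.continuous_of_bound F _
    (n.norm_dualDistrib_le ⟨f, hf.2⟩ ⟨g, hg.2⟩)⟩

end NormedTensor

end Tensor

end QuasiStarAlgebra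

theorem mainTheorem2
    {A₀ : Type u} {A : Type v} {B₀ : Type z} {B : Type w}
    [NonUnitalRing A₀] [StarRing A₀] [Module ℂ A₀] [IsScalarTower ℂ A₀ A₀]
    [SMulCommClass ℂ A₀ A₀] [StarModule ℂ A₀]
    [NonUnitalRing B₀] [StarRing B₀] [Module ℂ B₀] [IsScalarTower ℂ B₀ B₀]
    [SMulCommClass ℂ B₀ B₀] [StarModule ℂ B₀]
    [NormedAddCommGroup A] [NormedSpace ℂ A] [CompleteSpace A]
    [StarAddMonoid A] [StarModule ℂ A]
    [NormedAddCommGroup B] [NormedSpace ℂ B] [CompleteSpace B]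
    [StarAddMonoid B] [StarModule ℂ B]
    (Q : QuasiStarAlgebra A₀ A) (Q' : QuasiStarAlgebra B₀ B)
    (hQ : Q.IsNormed) (hQ' : Q'.IsNormed)
    (hQu : Q.IsUnital) (hQu' : Q'.IsUnital)
    (hQr : Q.IsFullyRepresentable) (hQr' : Q'.IsFullyRepresentable)
    (hQP : Q.ConditionP) (hQP' : Q'.ConditionP)
    (n : UniformCrossNorm A B) (hn : BarrelledSpace ℂ (NormedTensor n)) :
    ((∀ c : NormedTensor n, ‖star c‖ = ‖c‖) → (Q.normedTensor Q' n).IsNormed) ∧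
      (Q.normedTensor Q' n).IsFullyRepresentable := by
  have hdense := QuasiStarAlgebra.denseRange_normedTensor_ι (n := n) hQ.dense hQ'.dense
  obtain ⟨e, he, -⟩ := hQu
  obtain ⟨e', he', -⟩ := hQu'
  refine ⟨fun hstar =>
    ⟨hstar, hdense, QuasiStarAlgebra.continuous_normedTensor_rmul hQ hQ'⟩, ?_, ?_⟩
  -- Condition (P) is used only on the factors; the tensor product gets separation from product
  -- functionals.
  · refine QuasiStarAlgebra.isSufficient_contRep_of_separating fun c hc => ?_
    exact TensorProduct.eq_zero_of_forall_dualDistrib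
      (fun a => QuasiStarAlgebra.eq_zero_of_forall_contRep hQ hQr.1 hQP)
      (fun b => QuasiStarAlgebra.eq_zero_of_forall_contRep hQ' hQr'.1 hQP')
      fun f hf g hg => hc _ (QuasiStarAlgebra.dualDistrib_mem_contRep hf hg he he')
  · simp only [Set.iInter_eq_univ]
    exact fun ω hω => QuasiStarAlgebra.formDomain_eq_univ hω
      (QuasiStarAlgebra.tensor_unit he he')
      (QuasiStarAlgebra.continuous_normedTensor_lmul hQ hQ') hdense
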